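/- Let $X,Y$ be sets, $f:X\times Y\to\{0,1\}$ and $\varepsilon\in\mathbb R$ (the case of interest being $0\le\varepsilon<1/2$). In all models below Alice gets $x\in X$, Bob gets $y\in Y$, and they share randomness (an arbitrary probability space). An outcome must be correct with probability at least $1-\varepsilon$ on every input $(x,y)$, and each complexity is the least possible $t$ (it is $\infty$ if there is no such $t$). - $R^{\rightarrow}_\varepsilon(f)$: Alice sends $t$ bits to Bob, then Alice outputs a bit $a$ and Bob a bit $b$; correct means $a\oplus b=f(x,y)$. - $NL_\varepsilon(f)$: the players do not communicate but share $t$ labelled non-local boxes. A non-local box takes a bit $p$ from Alice and a bit $q$ from Bob and immediately returns to each player, upon that player's own input, a bit ($a$ to Alice, $b$ to Bob), with joint distribution $\Pr[a,b\mid p,q]=\frac12$ if $a\oplus b=p\cdot q$ and $0$ otherwise. Each player uses each box at most once, in an adaptively chosen order that may differ between the players, and finally outputs a bit; correct means that the XOR of the two final bits is $f(x,y)$. - $NL^{\mathrm{ord}}_\varepsilon(f)$: the same, but both players must use the boxes in the order of their labels $1,\dots,t$. - $R^{\parallel,MAJ}_\varepsilon(f)$: Alice and Bob send messages $\mathbf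 a,\mathbf b\in\{0,1\}^t$ to a referee, who outputs $MAJ(a_1\oplus b_1,\dots,a_t\oplus b_t)$, which is $1$ iff strictly more than $t/2$ of these bits are $1$; correct means that the referee outputs $f(x,y)$. Then there is an absolute constant $C$, independent of $X,Y,f$ and $\varepsilon$, such that $$R^{\rightarrow}_\varepsilon(f)\;\le\; NL_\varepsilon(f)\;\le\; NL^{\mathrm{ord}}_\varepsilon(f)\;\le\; C\cdot R^{\parallel,MAJ}_\varepsilon(f).$$ -/

import Mathlib

open MeasureTheory

universe u v

namespace NonLocal

/-! ### One-way communication with shared randomness -/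

/-- A one-way protocol with `t` bits of communication and shared randomness `Ω`: Alice sends a
`t`-bit message to Bob, then each player outputs one bit. -/
structure OneWayProtocol (X : Type u) (Y : Type v) (Ω : Type (max u v)) [MeasurableSpace Ω]
    (t : ℕ) where
  message : X → Ω → Fin t → Bool
  aliceOut : X → Ω → Bool
  bobOut : Y → Ω → (Fin t → Bool) → Bool
  measurable_message : ∀ x, Measurable (message x)
  measurable_aliceOut : ∀ x, Measurable (aliceOut x)
  measurable_bobOut : ∀ y, Measurable (bobOut y)

/-- There is a `t`-bit one-way protocol that computes `f` in parity with error at most `ε`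
on every input. -/
def OneWayComputes {X : Type u} {Y : Type v} (f : X → Y → Bool) (ε : ℝ) (t : ℕ) : Prop :=
  ∃ (Ω : Type (max u v)) (_ : MeasurableSpace Ω) (μ : Measure Ω) (_ : IsProbabilityMeasure μ)
    (P : OneWayProtocol X Y Ω t), ∀ x y,
      1 - ε ≤ μ.real {ω | xor (P.aliceOut x ω) (P.bobOut y ω (P.message x ω)) = f x y}

/-- `R^→_ε(f)`; it is `⊤` if no protocol exists. -/
noncomputable def oneWayComplexity {X : Type u} {Y : Type v} (f : X → Y → Bool) (ε : ℝ) : ℕ∞ :=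
  ⨅ (t : ℕ) (_ : OneWayComputes f ε t), (t : ℕ∞)

/-! ### Simultaneous messages with a majority referee -/

/-- The majority of `t` bits: it is `1` iff strictly more than half of the bits are `1`. -/
def maj {t : ℕ} (z : Fin t → Bool) : Bool :=
  decide (t < 2 * (Finset.univ.filter (fun i => z i = true)).card)

/-- A simultaneous-message protocol with shared randomness `Ω` in which Alice and Bob each send
a `t`-bit message to the referee. -/
structure SimultaneousProtocol (X : Type u) (Y : Type v) (Ω : Type (max u v)) [MeasurableSpace Ω]
    (t : ℕ) where
  aliceMsg : X → Ω → Fin t → Bool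
  bobMsg : Y → Ω → Fin t → Bool
  measurable_aliceMsg : ∀ x, Measurable (aliceMsg x)
  measurable_bobMsg : ∀ y, Measurable (bobMsg y)

/-- There is a simultaneous-message protocol with `t`-bit messages such that the majority of the
bitwise XORs of the messages is `f x y` with probability at least `1 - ε` on every input. -/
def MajComputes {X : Type u} {Y : Type v} (f : X → Y → Bool) (ε : ℝ) (t : ℕ) : Prop :=
  ∃ (Ω : Type (max u v)) (_ : MeasurableSpace Ω) (μ : Measure Ω) (_ : IsProbabilityMeasure μ)
    (P : SimultaneousProtocol X Y Ω t), ∀ x y,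
      1 - ε ≤ μ.real {ω | maj (fun i => xor (P.aliceMsg x ω i) (P.bobMsg y ω i)) = f x y}

/-- `R^{∥,MAJ}_ε(f)`: the length of each of the two messages; `⊤` if no protocol exists. -/
noncomputable def majComplexity {X : Type u} {Y : Type v} (f : X → Y → Bool) (ε : ℝ) : ℕ∞ :=
  ⨅ (t : ℕ) (_ : MajComputes f ε t), (t : ℕ∞)

/-! ### Non-local boxes -/

/-- The input-output distribution `p_NL(a, b | p, q)` of a non-local box. -/
noncomputable def boxProb (p q a b : Bool) : ℝ :=
  if xor a b = (p && q) then 1 / 2 else 0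

/-- The behaviour of one player, with input and shared randomness fixed, on his sides of `t`
labelled non-local boxes: either he stops and outputs a bit `c`, or he enters the bit `p` into
box `i`, immediately gets the output of the box, and continues depending on it. -/
inductive Strategy (t : ℕ) : Type
  | output (c : Bool) : Strategy t
  | query (i : Fin t) (p : Bool) (next : Bool → Strategy t) : Strategy t

namespace Strategy

instance (t : ℕ) : MeasurableSpace (Strategy t) := ⊤

/-- The bit that the player enters into box `i` when the boxes give him the outputs `a`. A box
that he leaves unused counts as getting the input `0` with its output ignored. -/
def input {t : ℕ} : Strategy t → (Fin t → Bool) → Fin t → Bool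
  | output _, _, _ => false
  | query j p next, a, i => if i = j then p else (next (a j)).input a i

/-- The final output of the player when the boxes give him the outputs `a`. -/
def result {t : ℕ} : Strategy t → (Fin t → Bool) → Bool
  | output c, _ => c
  | query j _ next, a => (next (a j)).result a

/-- No box in `U` is ever used, and no other box is used more than once. -/
def UsesOnce {t : ℕ} : Strategy t → Finset (Fin t) → Prop
  | output _, _ => True
  | query j _ next, U => j ∉ U ∧ ∀ a, (next a).UsesOnce (insert j U)

/-- The boxes are used in increasing order of their labels, all of which are at least `n`. -/
def InOrder {t : ℕ} : Strategy t → ℕ → Prop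
  | output _, _ => True
  | query j _ next, n => n ≤ (j : ℕ) ∧ ∀ a, (next a).InOrder ((j : ℕ) + 1)

/-- The probability that the XOR of the final outputs of two players with strategies `s` and `s'`
is `z`, when the joint distribution of the box outputs `a` (for Alice) and `b` (for Bob) is given
by independent non-local boxes. -/
noncomputable def parityProb {t : ℕ} (s s' : Strategy t) (z : Bool) : ℝ :=
  ∑ a : Fin t → Bool, ∑ b : Fin t → Bool,
    if xor (s.result a) (s'.result b) = z then
      ∏ i, boxProb (s.input a i) (s'.input b i) (a i) (b i)
    else 0

end Strategy

/-- A protocol with `t` non-local boxes, shared randomness `Ω` and no communication. Each player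
may use his sides of the boxes in any order, chosen adaptively. -/
structure BoxProtocol (X : Type u) (Y : Type v) (Ω : Type (max u v)) [MeasurableSpace Ω]
    (t : ℕ) where
  alice : X → Ω → Strategy t
  bob : Y → Ω → Strategy t
  measurable_alice : ∀ x, Measurable (alice x)
  measurable_bob : ∀ y, Measurable (bob y)
  usesOnce_alice : ∀ x ω, (alice x ω).UsesOnce ∅
  usesOnce_bob : ∀ y ω, (bob y ω).UsesOnce ∅

/-- Both players use the boxes in the order of their labels. -/
def BoxProtocol.Ordered {X : Type u} {Y : Type v} {Ω : Type (max u v)} [MeasurableSpace Ω] {t : ℕ}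
    (P : BoxProtocol X Y Ω t) : Prop :=
  (∀ x ω, (P.alice x ω).InOrder 0) ∧ ∀ y ω, (P.bob y ω).InOrder 0

/-- The probability, over the shared randomness and the boxes, that the XOR of the players' outputs
on input `(x, y)` is `z`. -/
noncomputable def BoxProtocol.parityProb {X : Type u} {Y : Type v} {Ω : Type (max u v)}
    [MeasurableSpace Ω] {t : ℕ} (P : BoxProtocol X Y Ω t) (μ : Measure Ω) (x : X) (y : Y)
    (z : Bool) : ℝ :=
  ∫ ω, (P.alice x ω).parityProb (P.bob y ω) z ∂μ

/-- There is a protocol with `t` non-local boxes that computes `f` in parity with error at most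
`ε` on every input. -/
def BoxComputes {X : Type u} {Y : Type v} (f : X → Y → Bool) (ε : ℝ) (t : ℕ) : Prop :=
  ∃ (Ω : Type (max u v)) (_ : MeasurableSpace Ω) (μ : Measure Ω) (_ : IsProbabilityMeasure μ)
    (P : BoxProtocol X Y Ω t), ∀ x y, 1 - ε ≤ P.parityProb μ x y (f x y)

/-- The same with both players using the boxes in the order of their labels. -/
def OrderedBoxComputes {X : Type u} {Y : Type v} (f : X → Y → Bool) (ε : ℝ) (t : ℕ) : Prop :=
  ∃ (Ω : Type (max u v)) (_ : MeasurableSpace Ω) (μ : Measure Ω) (_ : IsProbabilityMeasure μ)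
    (P : BoxProtocol X Y Ω t), P.Ordered ∧ ∀ x y, 1 - ε ≤ P.parityProb μ x y (f x y)

/-- `NL_ε(f)`; it is `⊤` if no protocol exists. -/
noncomputable def boxComplexity {X : Type u} {Y : Type v} (f : X → Y → Bool) (ε : ℝ) : ℕ∞ :=
  ⨅ (t : ℕ) (_ : BoxComputes f ε t), (t : ℕ∞)

/-- `NL^{ord}_ε(f)`; it is `⊤` if no protocol exists. -/
noncomputable def orderedBoxComplexity {X : Type u} {Y : Type v} (f : X → Y → Bool) (ε : ℝ) :
    ℕ∞ :=
  ⨅ (t : ℕ) (_ : OrderedBoxComputes f ε t), (t : ℕ∞)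

end NonLocal

/-! For the first inequality, fix Alice's box outputs `a`, which are uniform. Her inputs `p` follow
from `a`, and box `i` then answers Bob's `q` by `a i ⊕ p i q`. So with `a` as extra shared
randomness, sending `p` lets Bob replay his strategy in his own order (`UsesOnce.forall_input_iff`,
`UsesOnce.parityProb_eq`).

The second holds since ordered protocols are protocols. For the third, two boxes give the AND of two
XOR-shared bits (`forces_andGate`), hence a full adder. A row of adders replaces a list of shared
bits by carries whose number of ones is half the old one, rounded down (`forces_adderRow`).
Iterating leaves the top bit of the count, which is the majority after padding
(`forces_majority_paddedShare`). The rows shrink geometrically, so linearly many boxes suffice. -/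

namespace NonLocal

namespace Strategy

variable {t : ℕ}

/-! ### Resolving the boxes -/

/-- The box outputs seen by a player with strategy `s` if box `i` answers the input `q` by
`r i q`. -/
def transcript : Strategy t → (Fin t → Bool → Bool) → Fin t → Bool
  | output _, r, i => r i false
  | query j p next, r, i => if i = j then r j p else (next (r j p)).transcript r i

/-- The first input is independent of `b`, so it fixes `b j` and thereby the next strategy, which
never returns to box `j`. The circular-looking system thus has one solution off `U`. -/
theorem UsesOnce.forall_eq_iff {s : Strategy t} {U : Finset (Fin t)} (hs : s.UsesOnce U)
    (r : Fin t → Bool → Bool) (b : Fin t → Bool) :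
    (∀ i ∉ U, b i = r i (s.input b i)) ↔ ∀ i ∉ U, b i = s.transcript r i := by
  induction s generalizing U with
  | output c => rfl
  | query j p next ih =>
    obtain ⟨hj, hnext⟩ := hs
    have split (P : Fin t → Prop) : (∀ i ∉ U, P i) ↔ P j ∧ ∀ i ∉ insert j U, P i := by
      refine ⟨fun h => ⟨h j hj, fun i hi => h i fun hU => hi (Finset.mem_insert_of_mem hU)⟩, ?_⟩
      rintro ⟨h₁, h₂⟩ i hi
      by_cases hij : i = j
      · exact hij ▸ h₁
      · exact h₂ i (by simp [hij, hi])
    rw [split, split]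
    have hne {i : Fin t} (hi : i ∉ insert j U) : i ≠ j := by
      rintro rfl; exact hi (Finset.mem_insert_self _ _)
    have h₁ : (∀ i ∉ insert j U, b i = r i ((query j p next).input b i)) ↔
        ∀ i ∉ insert j U, b i = r i ((next (b j)).input b i) :=
      forall₂_congr fun i hi => by simp [input, hne hi]
    have h₂ : (∀ i ∉ insert j U, b i = (query j p next).transcript r i) ↔
        ∀ i ∉ insert j U, b i = (next (r j p)).transcript r i :=
      forall₂_congr fun i hi => by simp [transcript, hne hi]
    rw [h₁, h₂, ih (b j) (hnext _)]
    simp only [input, transcript, if_true]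
    exact and_congr_right fun h => by rw [h]

theorem UsesOnce.forall_input_iff {s : Strategy t} (hs : s.UsesOnce ∅)
    (r : Fin t → Bool → Bool) (b : Fin t → Bool) :
    (∀ i, b i = r i (s.input b i)) ↔ b = s.transcript r := by
  simpa [funext_iff] using hs.forall_eq_iff r b

/-- The output of Bob with strategy `s` if Alice enters `p` into the boxes and receives `a`. -/
def response (s : Strategy t) (p a : Fin t → Bool) : Bool :=
  s.result (s.transcript fun i q => xor (a i) (p i && q))

theorem prod_boxProb (p q a b : Fin t → Bool) :
    ∏ i, boxProb (p i) (q i) (a i) (b i) =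
      if ∀ i, b i = xor (a i) (p i && q i) then (1 / 2 : ℝ) ^ t else 0 := by
  have key (i : Fin t) : xor (a i) (b i) = (p i && q i) ↔ b i = xor (a i) (p i && q i) := by
    cases a i <;> cases b i <;> cases p i <;> cases q i <;> decide
  simp only [boxProb, key]
  rw [Finset.prod_ite_zero]
  simp

/-- For each `a`, exactly one `b` has nonzero weight, namely Bob's transcript. -/
theorem UsesOnce.parityProb_eq {s' : Strategy t} (hs' : s'.UsesOnce ∅) (s : Strategy t)
    (z : Bool) :
    s.parityProb s' z = ∑ a : Fin t → Bool,
      if xor (s.result a) (s'.response (s.input a) a) = z then (1 / 2 : ℝ) ^ t else 0 := by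
  unfold Strategy.parityProb
  refine Finset.sum_congr rfl fun a _ => ?_
  simp only [prod_boxProb,
    hs'.forall_input_iff (fun i q => xor (a i) (s.input a i && q))]
  rw [Finset.sum_eq_single (s'.transcript fun i q => xor (a i) (s.input a i && q))]
  · simp [response]
  · intro b _ hb
    simp [hb]
  · simp

theorem parityProb_eq_one {s s' : Strategy t} (hs' : s'.UsesOnce ∅) {z : Bool}
    (h : ∀ a b : Fin t → Bool, (∀ i, xor (a i) (b i) = (s.input a i && s'.input b i)) →
      xor (s.result a) (s'.result b) = z) :
    s.parityProb s' z = 1 := by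
  rw [hs'.parityProb_eq]
  have key (a : Fin t → Bool) : xor (s.result a) (s'.response (s.input a) a) = z := by
    refine h a _ fun i => ?_
    have := (hs'.forall_input_iff (fun i q => xor (a i) (s.input a i && q)) _).2 rfl i
    rw [this]
    simp
  simp [key]

theorem parityProb_nonneg (s s' : Strategy t) (z : Bool) : 0 ≤ s.parityProb s' z := by
  refine Finset.sum_nonneg fun a _ => Finset.sum_nonneg fun b _ => ?_
  split_ifs
  · refine Finset.prod_nonneg fun i _ => ?_
    unfold boxProb
    split_ifs <;> norm_num
  · rfl

/-! ### Ordered strategies -/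

theorem InOrder.usesOnce {s : Strategy t} {n : ℕ} (hs : s.InOrder n) {U : Finset (Fin t)}
    (hU : ∀ j ∈ U, (j : ℕ) < n) : s.UsesOnce U := by
  induction s generalizing n U with
  | output c => trivial
  | query j p next ih =>
    obtain ⟨hj, hnext⟩ := hs
    refine ⟨fun h => absurd (hU j h) (by omega), fun a => ih a (hnext a) fun i hi => ?_⟩
    rcases Finset.mem_insert.1 hi with rfl | hi
    · omega
    · have := hU i hi
      omega

/-- If the boxes with labels at least `n` behave as non-local boxes, then the outputs of the two
players have the XOR `z`. -/
def Forces (n : ℕ) (s s' : Strategy t) (z : Bool) : Prop :=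
  ∀ a b : Fin t → Bool,
    (∀ i : Fin t, n ≤ (i : ℕ) → xor (a i) (b i) = (s.input a i && s'.input b i)) →
      xor (s.result a) (s'.result b) = z

/-- Enter `p` into the box with label `i` and continue with `k`; stop if there is no such box. -/
def ask (i : ℕ) (p : Bool) (k : Bool → Strategy t) : Strategy t :=
  if h : i < t then query ⟨i, h⟩ p k else output false

theorem inOrder_ask {i n : ℕ} (hn : n ≤ i) (p : Bool) {k : Bool → Strategy t}
    (hk : ∀ a, (k a).InOrder (i + 1)) : (ask i p k).InOrder n := by
  unfold ask
  split_ifs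
  · exact ⟨hn, hk⟩
  · trivial

theorem forces_ask {i : ℕ} (hi : i < t) {p p' : Bool} {k k' : Bool → Strategy t} {z : Bool}
    (h : ∀ a b, xor a b = (p && p') → Forces (i + 1) (k a) (k' b) z) :
    Forces i (ask i p k) (ask i p' k') z := by
  intro a b hab
  simp only [ask, hi, dif_pos, result, input] at hab ⊢
  refine h _ _ (by simpa using hab ⟨i, hi⟩ le_rfl) a b fun j hj => ?_
  have hne : j ≠ ⟨i, hi⟩ := by rintro rfl; simp at hj
  simpa [hne] using hab j (by omega)

/-! ### Computing on shared bits -/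

/-- One player's part of the conjunction of two shared bits, of which he holds the shares `u` and
`v`; it uses the boxes `i` and `i + 1`, and `k` gets his share of the result. The flag tells the
players apart. -/
def andGate (σ : Bool) (i : ℕ) (u v : Bool) (k : Bool → Strategy t) : Strategy t :=
  ask i (if σ then u else v) fun r => ask (i + 1) (if σ then v else u) fun r' =>
    k (xor (u && v) (xor r r'))

theorem inOrder_andGate {σ : Bool} {i n : ℕ} (hn : n ≤ i) (u v : Bool) {k : Bool → Strategy t}
    (hk : ∀ c, (k c).InOrder (i + 2)) : (andGate σ i u v k).InOrder n :=
  inOrder_ask hn _ fun _ => inOrder_ask le_rfl _ fun _ => hk _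

/-- In `(u ⊕ u')(v ⊕ v')` the terms `uv` and `u'v'` are local; one box shares `uv'` and the other
`vu'`. -/
theorem forces_andGate {i : ℕ} (hi : i + 2 ≤ t) {u v u' v' : Bool} {k k' : Bool → Strategy t}
    {z : Bool}
    (h : ∀ c c', xor c c' = (xor u u' && xor v v') → Forces (i + 2) (k c) (k' c') z) :
    Forces i (andGate true i u v k) (andGate false i u' v' k') z := by
  refine forces_ask (by omega) fun a b hab => forces_ask (by omega) fun a' b' hab' => h _ _ ?_
  clear h
  revert hab hab'
  revert u v u' v' a b a' b'
  decide

/-- A row of full adders: the input bits, starting with `s`, are added up, and `k` gets the label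
of the next box and the list of the carries. -/
def adderRow (σ : Bool) : ℕ → Bool → List Bool → (ℕ → List Bool → Strategy t) → Strategy t
  | i, s, x :: y :: l, k => andGate σ i (xor s x) (xor s y) fun c =>
      adderRow σ (i + 2) (xor s (xor x y)) l fun j cs => k j (xor s c :: cs)
  | i, _, _, k => k i []

theorem inOrder_adderRow (σ : Bool) (i : ℕ) (s : Bool) (l : List Bool)
    {k : ℕ → List Bool → Strategy t} (hk : ∀ j cs, (k j cs).InOrder j) :
    (adderRow σ i s l k).InOrder i := by
  induction i, s, l, k using adderRow.induct with
  | case1 i s x y l k ih =>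
    rw [adderRow]
    exact inOrder_andGate le_rfl _ _ fun c => ih c fun j cs => hk _ _
  | case2 i s l k hl =>
    rw [adderRow]
    · exact hk _ _
    · exact hl

/-- The number of ones among a list of shared bits. -/
def sharedCount (l : List (Bool × Bool)) : ℕ :=
  (l.map fun p => (xor p.1 p.2).toNat).sum

/-- The carry of `s, x, y` is `s ⊕ (s ⊕ x)(s ⊕ y)`, which costs one AND; the sum bit is local. The
total is twice the carries plus the last sum bit, which is dropped. -/
theorem forces_adderRow {m : ℕ} {l : List (Bool × Bool)} (hl : l.length = 2 * m) {i : ℕ}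
    (hi : i + 2 * m ≤ t) {p : Bool × Bool} {k k' : ℕ → List Bool → Strategy t} {z : Bool}
    (h : ∀ cs : List (Bool × Bool), cs.length = m →
      2 * sharedCount cs ≤ sharedCount (p :: l) → sharedCount (p :: l) ≤ 2 * sharedCount cs + 1 →
      Forces (i + 2 * m) (k (i + 2 * m) (cs.map Prod.fst))
        (k' (i + 2 * m) (cs.map Prod.snd)) z) :
    Forces i (adderRow true i p.1 (l.map Prod.fst) k)
      (adderRow false i p.2 (l.map Prod.snd) k') z := by
  induction m generalizing l i p k k' with
  | zero =>
    obtain rfl := List.length_eq_zero_iff.1 hl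
    refine h [] rfl ?_ ?_
    · simp [sharedCount]
    · simpa [sharedCount] using Bool.toNat_le _
  | succ m ih =>
    match l, hl with
    | x :: y :: l, hl =>
      refine forces_andGate (by omega) fun c c' hc => ?_
      refine ih (p := (xor p.1 (xor x.1 y.1), xor p.2 (xor x.2 y.2)))
        (by simp at hl; omega) (by omega) fun cs hcs h₁ h₂ => ?_
      have hadd : (xor p.1 p.2).toNat + (xor x.1 x.2).toNat + (xor y.1 y.2).toNat =
          2 * (xor (xor p.1 c) (xor p.2 c')).toNat +
            (xor (xor p.1 (xor x.1 y.1)) (xor p.2 (xor x.2 y.2))).toNat := by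
        revert hc
        clear h₁ h₂ ih h hl
        obtain ⟨p₁, p₂⟩ := p
        obtain ⟨x₁, x₂⟩ := x
        obtain ⟨y₁, y₂⟩ := y
        revert p₁ p₂ x₁ x₂ y₁ y₂ c c'
        decide
      have := h ((xor p.1 c, xor p.2 c') :: cs) (by simp [hcs])
        (by simp [sharedCount] at *; omega) (by simp [sharedCount] at *; omega)
      rwa [Nat.mul_succ, Nat.add_comm (2 * m) 2, ← Nat.add_assoc] at this

/-- One player's part of the majority of `2 ^ (n + 1) - 1` shared bits. -/
def majority (σ : Bool) : ℕ → ℕ → List Bool → Strategy t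
  | 0, _, l => output l.headI
  | _ + 1, _, [] => output false
  | n + 1, i, s :: l => adderRow σ i s l (majority σ n)

theorem inOrder_majority (σ : Bool) (n i : ℕ) (l : List Bool) :
    (majority (t := t) σ n i l).InOrder i := by
  induction n generalizing i l with
  | zero => trivial
  | succ n ih =>
    cases l with
    | nil => trivial
    | cons s l => exact inOrder_adderRow σ i s l fun j cs => ih j cs

theorem forces_majority {n : ℕ} {l : List (Bool × Bool)} (hl : l.length + 1 = 2 ^ (n + 1))
    {i : ℕ} (hi : i + 4 * 2 ^ n ≤ t + 4) :
    Forces (t := t) i (majority true n i (l.map Prod.fst)) (majority false n i (l.map Prod.snd))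
      (decide (2 ^ n ≤ sharedCount l)) := by
  induction n generalizing l i with
  | zero =>
    match l, hl with
    | [], hl => simp at hl
    | _ :: _ :: _, hl => simp at hl
    | [p], _ =>
      intro a b _
      obtain ⟨p₁, p₂⟩ := p
      cases p₁ <;> cases p₂ <;> rfl
  | succ n ih =>
    have hpos : 0 < 2 ^ n := by positivity
    match l, hl with
    | [], hl => simp at hl; omega
    | p :: l, hl =>
      have e₁ : 2 ^ (n + 1) = 2 * 2 ^ n := by ring
      have e₂ : 2 ^ (n + 1 + 1) = 4 * 2 ^ n := by ring
      -- One bit seeds the running sum and the other `2 ^ (n + 2) - 2` enter in pairs. Halving the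
      -- count with rounding down preserves the comparison with the halved threshold.
      refine forces_adderRow (m := 2 ^ (n + 1) - 1) (by simp at hl; omega) (by omega)
        fun cs hcs h₁ h₂ => ?_
      have := ih (l := cs) (i := i + 2 * (2 ^ (n + 1) - 1)) (by omega) (by omega)
      rwa [show decide (2 ^ (n + 1) ≤ sharedCount (p :: l)) = decide (2 ^ n ≤ sharedCount cs) from
        decide_eq_decide.2 (by omega)]

/-- One player's share of a `t`-bit string, padded with `p` ones and with `q` zeros. -/
def paddedShare (σ : Bool) (p q : ℕ) {m : ℕ} (z : Fin m → Bool) : List Bool :=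
  List.replicate p σ ++ List.ofFn z ++ List.replicate q false

theorem sharedCount_ofFn {m : ℕ} (a b : Fin m → Bool) :
    sharedCount (List.ofFn fun i => (a i, b i)) =
      (Finset.univ.filter fun i => xor (a i) (b i) = true).card := by
  rw [sharedCount, List.map_ofFn, List.sum_ofFn, Finset.card_filter]
  refine Finset.sum_congr rfl fun i _ => ?_
  simp only [Function.comp]
  cases xor (a i) (b i) <;> rfl

/-- The ones raise the threshold from `m / 2 + 1` to `2 ^ n`; the zeros bring the length to `2 ^ (n
+ 1) - 1`. -/
theorem forces_majority_paddedShare {m n : ℕ} (hn : m / 2 + 1 ≤ 2 ^ n)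
    (ht : 4 * 2 ^ n ≤ t + 4) (a b : Fin m → Bool) :
    Forces (t := t) 0
      (majority true n 0
        (paddedShare true (2 ^ n - (m / 2 + 1)) (2 ^ n + m / 2 - m) a))
      (majority false n 0
        (paddedShare false (2 ^ n - (m / 2 + 1)) (2 ^ n + m / 2 - m) b))
      (maj fun i => xor (a i) (b i)) := by
  have := forces_majority (t := t) (n := n) (i := 0)
    (l := List.replicate (2 ^ n - (m / 2 + 1)) (true, false) ++ List.ofFn (fun i => (a i, b i)) ++
      List.replicate (2 ^ n + m / 2 - m) (false, false))
    (by simp; omega) (by omega)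
  have hcount : sharedCount (List.replicate (2 ^ n - (m / 2 + 1)) (true, false) ++
      List.ofFn (fun i => (a i, b i)) ++ List.replicate (2 ^ n + m / 2 - m) (false, false)) =
      2 ^ n - (m / 2 + 1) + (Finset.univ.filter fun i => xor (a i) (b i) = true).card := by
    rw [← sharedCount_ofFn]
    simp [sharedCount]
  rw [hcount] at this
  rw [show maj (fun i => xor (a i) (b i)) = _ from decide_eq_decide.2 ?_]
  · simpa only [paddedShare, List.map_append, List.map_replicate, List.map_ofFn,
      Function.comp_def] using this
  · beta_reduce
    omega

end Strategy

/-! ### Comparing the models -/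

section Models

variable {X : Type u} {Y : Type v}

theorem OrderedBoxComputes.boxComputes {f : X → Y → Bool} {ε : ℝ} {t : ℕ}
    (h : OrderedBoxComputes f ε t) : BoxComputes f ε t := by
  obtain ⟨Ω, m, μ, hμ, P, -, hP⟩ := h
  exact ⟨Ω, m, μ, hμ, P, hP⟩

theorem exists_two_pow_between {k : ℕ} (hk : k ≠ 0) : ∃ n, k ≤ 2 ^ n ∧ 2 ^ n ≤ 2 * k - 1 := by
  refine ⟨Nat.clog 2 k, Nat.le_pow_clog one_lt_two k, ?_⟩
  rcases Nat.lt_or_ge 1 k with h | h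
  · have h₁ := Nat.pow_pred_clog_lt_self one_lt_two h
    have h₂ := Nat.clog_pos one_lt_two h
    obtain ⟨c, hc⟩ := Nat.exists_eq_succ_of_ne_zero h₂.ne'
    rw [hc] at h₁ ⊢
    simp only [Nat.pred_eq_sub_one, Nat.succ_eq_add_one, Nat.add_sub_cancel, pow_succ] at h₁ ⊢
    omega
  · obtain rfl : k = 1 := by omega
    simp

theorem MajComputes.orderedBoxComputes {f : X → Y → Bool} {ε : ℝ} {t : ℕ}
    (h : MajComputes f ε t) : OrderedBoxComputes f ε (4 * t) := by
  obtain ⟨Ω, m, μ, hμ, P, hP⟩ := h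
  -- Here `2 ^ n ≤ 2 * (t / 2) + 1 ≤ t + 1`, so `4 * 2 ^ n - 4` boxes fit into `4 * t`.
  obtain ⟨n, hn, hn'⟩ := exists_two_pow_between (Nat.succ_ne_zero (t / 2))
  let strategy (σ : Bool) (z : Fin t → Bool) : Strategy (4 * t) :=
    Strategy.majority σ n 0
      (Strategy.paddedShare σ (2 ^ n - (t / 2 + 1)) (2 ^ n + t / 2 - t) z)
  have horder (σ : Bool) (z : Fin t → Bool) : (strategy σ z).InOrder 0 :=
    Strategy.inOrder_majority ..
  have honce (σ : Bool) (z : Fin t → Bool) : (strategy σ z).UsesOnce ∅ :=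
    (horder σ z).usesOnce (by simp)
  have hone (a b : Fin t → Bool) :
      (strategy true a).parityProb (strategy false b) (maj fun i => xor (a i) (b i)) = 1 :=
    Strategy.parityProb_eq_one (honce _ _) fun r r' hr =>
      Strategy.forces_majority_paddedShare hn (by omega) a b r r' fun i _ => hr i
  let Q : BoxProtocol X Y Ω (4 * t) :=
    { alice := fun x ω => strategy true (P.aliceMsg x ω)
      bob := fun y ω => strategy false (P.bobMsg y ω)
      measurable_alice := fun x => (measurable_of_finite (strategy true)).comp (P.measurable_aliceMsg x)
      measurable_bob := fun y => (measurable_of_finite (strategy false)).comp (P.measurable_bobMsg y)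
      usesOnce_alice := fun _ _ => honce _ _
      usesOnce_bob := fun _ _ => honce _ _ }
  refine ⟨Ω, m, μ, hμ, Q, ⟨fun _ _ => horder _ _, fun _ _ => horder _ _⟩, fun x y => ?_⟩
  refine (hP x y).trans ?_
  have hpair : Measurable fun ω => (P.aliceMsg x ω, P.bobMsg y ω) :=
    (P.measurable_aliceMsg x).prodMk (P.measurable_bobMsg y)
  have hmeas : MeasurableSet
      {ω | maj (fun i => xor (P.aliceMsg x ω i) (P.bobMsg y ω i)) = f x y} :=
    hpair (Set.toFinite {p : (Fin t → Bool) × (Fin t → Bool) |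
      maj (fun i => xor (p.1 i) (p.2 i)) = f x y}).measurableSet
  have hint : Integrable (fun ω => (Q.alice x ω).parityProb (Q.bob y ω) (f x y)) μ :=
    Integrable.comp_measurable (f := fun ω => (P.aliceMsg x ω, P.bobMsg y ω))
      (g := fun p => (strategy true p.1).parityProb (strategy false p.2) (f x y)) .of_finite hpair
  -- Pointwise, the box protocol succeeds with probability one wherever the referee is correct.
  rw [← integral_indicator_one hmeas]
  refine integral_mono ((integrable_const (1 : ℝ)).indicator hmeas) hint fun ω => ?_
  refine Set.indicator_apply_le' (fun hω => ?_) fun _ => Strategy.parityProb_nonneg _ _ _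
  have := hone (P.aliceMsg x ω) (P.bobMsg y ω)
  rw [show maj _ = f x y from hω] at this
  exact this.ge

theorem BoxComputes.oneWayComputes {f : X → Y → Bool} {ε : ℝ} {t : ℕ}
    (h : BoxComputes f ε t) : OneWayComputes f ε t := by
  obtain ⟨Ω, m, μ, hμ, P, hP⟩ := h
  let ν : Measure (Fin t → Bool) := (PMF.uniformOfFintype (Fin t → Bool)).toMeasure
  have hν (a : Fin t → Bool) : ν.real {a} = (1 / 2 : ℝ) ^ t := by
    simp [ν, Measure.real]
  let Q : OneWayProtocol X Y (Ω × (Fin t → Bool)) t :=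
    { message := fun x ω => (P.alice x ω.1).input ω.2
      aliceOut := fun x ω => (P.alice x ω.1).result ω.2
      bobOut := fun y ω p => (P.bob y ω.1).response p ω.2
      -- As `a` ranges over a finite set, it may be fixed; every map out of `Strategy t` is
      -- measurable.
      measurable_message := fun x => measurable_from_prod_countable_left fun a =>
        (measurable_from_top (f := fun s : Strategy t => s.input a)).comp (P.measurable_alice x)
      measurable_aliceOut := fun x => measurable_from_prod_countable_left fun a =>
        (measurable_from_top (f := fun s : Strategy t => s.result a)).comp (P.measurable_alice x)
      measurable_bobOut := fun y => measurable_from_prod_countable_left fun a =>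
        (measurable_from_top (f := fun (s : Strategy t) p => s.response p a)).comp
          (P.measurable_bob y) }
  refine ⟨Ω × (Fin t → Bool), inferInstance, μ.prod ν, inferInstance, Q, fun x y => ?_⟩
  refine (hP x y).trans_eq ?_
  have hmeas : MeasurableSet {ω : Ω × (Fin t → Bool) |
      xor (Q.aliceOut x ω) (Q.bobOut y ω (Q.message x ω)) = f x y} :=
    ((Q.measurable_aliceOut x).prodMk ((Q.measurable_bobOut y).prodMk (Q.measurable_message x)))
      (Set.toFinite {p : Bool × ((Fin t → Bool) → Bool) × (Fin t → Bool) |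
        xor p.1 (p.2.1 p.2.2) = f x y}).measurableSet
  rw [← integral_indicator_one hmeas, integral_prod]
  · refine integral_congr_ae (Filter.Eventually.of_forall fun ω => ?_)
    beta_reduce
    rw [integral_fintype .of_finite]
    simp only [hν, (P.usesOnce_bob y ω).parityProb_eq]
    refine Finset.sum_congr rfl fun a _ => ?_
    simp [Set.indicator_apply, Q]
  · exact (integrable_const (1 : ℝ)).indicator hmeas

end Models

end NonLocal

theorem mainTheorem4 :
    ∃ C : ℕ, ∀ (X : Type u) (Y : Type v) (f : X → Y → Bool) (ε : ℝ),
      NonLocal.oneWayComplexity f ε ≤ NonLocal.boxComplexity f ε ∧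
      NonLocal.boxComplexity f ε ≤ NonLocal.orderedBoxComplexity f ε ∧
      NonLocal.orderedBoxComplexity f ε ≤ (C : ℕ∞) * NonLocal.majComplexity f ε := by
  refine ⟨4, fun X Y f ε => ⟨?_, ?_, ?_⟩⟩
  · exact le_iInf₂ fun t h => iInf₂_le t h.oneWayComputes
  · exact le_iInf₂ fun t h => iInf₂_le t h.boxComputes
  · rw [NonLocal.majComplexity, ENat.mul_iInf_of_ne (by simp)]
    refine le_iInf fun t => ?_
    rw [ENat.mul_iInf_of_ne (by simp)]
    refine le_iInf fun h => (iInf₂_le (4 * t) h.orderedBoxComputes).trans_eq ?_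
    push_cast
    rfl
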